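/- Let $\mathcal V$ be a countably infinite set of variables. A term rewrite system (TRS) consists of a signature $\mathcal F$ (a set of function symbols, each with a fixed arity) and a set of rewrite rules $\ell \to r$, where $\ell$ and $r$ are terms over $\mathcal F$ and $\mathcal V$, $\ell$ is not a variable, and every variable of $r$ occurs in $\ell$. Its rewrite relation, on the set $\mathcal T(\mathcal F,\mathcal V)$ of terms over $\mathcal F$ and $\mathcal V$, replaces a subterm $\ell\sigma$ by $r\sigma$, for a rule $\ell\to r$ and a substitution $\sigma\colon\mathcal V\to\mathcal T(\mathcal F,\mathcal V)$. The TRS is confluent if, whenever $s \to^* t$ and $s \to^* u$ for its rewrite relation $\to$, there is a term $v$ with $t \to^* v$ and $u \to^* v$. **Theorem (Toyama).** Let $\mathcal R_1$ and $\mathcal R_2$ be TRSs over signatures $\mathcal F_1$ and $\mathcal F_2$, respectively, with $\mathcal F_1 \cap \mathcal F_2 = \varnothing$. If $\mathcal R_1$ and $\mathcal R_2$ are both confluent, then the TRS $\mathcal R_1 \cup \mathcal R_2$ over the signature $\mathcal F_1 \cup \mathcal F_2$ is confluent. -/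

import Mathlib

universe u v w

namespace TermRewriting

/-- Function symbols with their arities. The language `L` only serves as a universe of function
symbols; a signature is a set of such symbols. Relation symbols of `L` play no role. -/
abbrev Sym (L : FirstOrder.Language.{u, v}) : Type u := Σ n : ℕ, L.Functions n

variable {L : FirstOrder.Language.{u, v}} {V : Type w}

/-- `IsTermOver F t` says that `t ∈ T(F, V)`: every function symbol in `t` belongs to `F`. -/
def IsTermOver (F : Set (Sym L)) : L.Term V → Prop
  | .var _ => True
  | .func f ts => (⟨_, f⟩ : Sym L) ∈ F ∧ ∀ i, IsTermOver F (ts i)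

theorem IsTermOver.mono {F G : Set (Sym L)} (h : F ⊆ G) :
    ∀ {t : L.Term V}, IsTermOver F t → IsTermOver G t
  | .var _, _ => trivial
  | .func _ _, ht => ⟨h ht.1, fun i => IsTermOver.mono h (ht.2 i)⟩

open Classical in
/-- The set of variables occurring in a term. -/
noncomputable def vars (t : L.Term V) : Set V := ↑t.varFinset

variable (L V) in
/-- A term rewrite system: a signature together with a set of rewrite rules `ℓ → r` (pairs
`(ℓ, r)`) between terms over this signature, where `ℓ` is not a variable and every variable
of `r` occurs in `ℓ`. -/
structure TRS where
  sig : Set (Sym L)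
  rules : Set (L.Term V × L.Term V)
  lhs_over : ∀ ρ ∈ rules, IsTermOver sig ρ.1
  rhs_over : ∀ ρ ∈ rules, IsTermOver sig ρ.2
  lhs_not_var : ∀ ρ ∈ rules, ∀ x : V, ρ.1 ≠ .var x
  vars_subset : ∀ ρ ∈ rules, vars ρ.2 ⊆ vars ρ.1

/-- One rewrite step with a set of rules: an instance `ℓσ` of a left-hand side, at any position of
the term, is replaced by `rσ`. -/
inductive Step (R : Set (L.Term V × L.Term V)) : L.Term V → L.Term V → Prop
  | root {l r : L.Term V} (h : (l, r) ∈ R) (σ : V → L.Term V) : Step R (l.subst σ) (r.subst σ)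
  | arg {n : ℕ} (f : L.Functions n) (ts : Fin n → L.Term V) (i : Fin n) {t : L.Term V}
      (h : Step R (ts i) t) : Step R (.func f ts) (.func f (Function.update ts i t))

/-- A relation is confluent if `b *← a →* c` implies `b →* d *← c` for some `d`. -/
def Confluent {α : Type*} (r : α → α → Prop) : Prop :=
  ∀ a b c : α, Relation.ReflTransGen r a b → Relation.ReflTransGen r a c →
    Relation.Join (Relation.ReflTransGen r) b c

namespace TRS

/-- The terms over the signature of a TRS. -/
def Terms (R : TRS L V) : Type (max u w) := {t : L.Term V // IsTermOver R.sig t}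

/-- The rewrite relation of a TRS, on the terms over its signature. (As the terms before and after
the step are over the signature, and variables of `r` occur in `ℓ`, the substitution in the step
can always be taken to have values over the signature.) -/
def Rewrites (R : TRS L V) (s t : R.Terms) : Prop := Step R.rules s.1 t.1

/-- A TRS is confluent if its rewrite relation is. -/
def IsConfluent (R : TRS L V) : Prop := Confluent R.Rewrites

/-- The union of two TRSs: unite the signatures and the sets of rules. -/
def union (R₁ R₂ : TRS L V) : TRS L V where
  sig := R₁.sig ∪ R₂.sig
  rules := R₁.rules ∪ R₂.rules
  lhs_over := by
    rintro ρ (h | h)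
    · exact (R₁.lhs_over ρ h).mono Set.subset_union_left
    · exact (R₂.lhs_over ρ h).mono Set.subset_union_right
  rhs_over := by
    rintro ρ (h | h)
    · exact (R₁.rhs_over ρ h).mono Set.subset_union_left
    · exact (R₂.rhs_over ρ h).mono Set.subset_union_right
  lhs_not_var := by
    rintro ρ (h | h)
    · exact R₁.lhs_not_var ρ h
    · exact R₂.lhs_not_var ρ h
  vars_subset := by
    rintro ρ (h | h)
    · exact R₁.vars_subset ρ h
    · exact R₂.vars_subset ρ h

end TRS

end TermRewriting

/-!
A term is cut at the positions where its symbols change from one signature to another. Its top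
layer is a term over one signature, whose variables are the *aliens*, i.e. the maximal subterms
with a root outside of that signature. Each class of joinable layers gets a canonical
representative, and replacing the layers by their representatives from the bottom up assigns to
every term `t` a term `nf t` which is invariant under rewriting. It remains to see that
`nf s = nf t` implies that `s` and `t` are joinable. The representative of a class is a variable as
soon as the class contains one. Hence, if `nf` destroys the top layer of a term, then this layer
rewrites to an alien, so every term rewrites to a stable one, in which `nf` keeps the layers apart.
For stable terms one argues by induction on the number of layers: aliens with the same normal form
are first rewritten to a common reduct, and then the top layers are joined in the system they
belong to.
-/

namespace TermRewriting

open Relation Function FirstOrder.Language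

theorem exists_bound_on_fibers {α β : Type*} [Nonempty α] {r : α → α → Prop} [IsTrans α r]
    {P : Set α} {key : α → β} (hdir : ∀ k, DirectedOn r {a ∈ P | key a = k}) {A : Set α}
    (hA : A.Finite) (hAP : A ⊆ P) : ∃ φ : β → α, ∀ a ∈ A, r a (φ (key a)) := by
  have exists_bound (k : β) : ∃ e, ∀ a ∈ A, key a = k → r a e := by
    obtain hempty | ⟨b, hb⟩ := {a ∈ P | key a = k}.eq_empty_or_nonempty
    · inhabit α
      exact ⟨default, fun a ha hk => (hempty.le ⟨hAP ha, hk⟩).elim⟩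
    · have : Nonempty {a ∈ P | key a = k} := ⟨⟨b, hb⟩⟩
      obtain ⟨e, he⟩ := (hdir k).directed_val.finite_set_le
        (hA.preimage Subtype.val_injective.injOn)
      exact ⟨e, fun a ha hk => he ⟨a, hAP ha, hk⟩ ha⟩
  choose φ hφ using exists_bound
  exact ⟨φ, fun a ha => hφ _ a ha rfl⟩

section Terms

variable {L : FirstOrder.Language.{u, v}} {V W X : Type*} {F : Set (Sym L)}

@[simp]
theorem mem_vars_var {x y : V} : x ∈ vars (.var y : L.Term V) ↔ x = y := by
  simp [vars, Term.varFinset]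

@[simp]
theorem mem_vars_func {n : ℕ} {f : L.Functions n} {ts : Fin n → L.Term V} {x : V} :
    x ∈ vars (.func f ts) ↔ ∃ i, x ∈ vars (ts i) := by
  simp [vars, Term.varFinset]

theorem finite_vars (t : L.Term V) : (vars t).Finite := Finset.finite_toSet _

@[simp]
theorem subst_var (x : V) (σ : V → L.Term W) : (Term.var x : L.Term V).subst σ = σ x := rfl

@[simp]
theorem subst_func {n : ℕ} (f : L.Functions n) (ts : Fin n → L.Term V) (σ : V → L.Term W) :
    (Term.func f ts).subst σ = .func f fun i => (ts i).subst σ := rfl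

theorem subst_subst (t : L.Term V) (σ : V → L.Term W) (τ : W → L.Term X) :
    (t.subst σ).subst τ = t.subst fun x => (σ x).subst τ := by
  induction t with
  | var x => rfl
  | func f ts ih => simp [ih]

theorem subst_congr {t : L.Term V} {σ τ : V → L.Term W} (h : ∀ x ∈ vars t, σ x = τ x) :
    t.subst σ = t.subst τ := by
  induction t with
  | var x => exact h x (mem_vars_var.2 rfl)
  | func f ts ih =>
    exact congrArg (Term.func f) (funext fun i => ih i fun x hx => h x (mem_vars_func.2 ⟨i, hx⟩))

@[simp]
theorem subst_termVar (t : L.Term V) : t.subst Term.var = t := by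
  induction t with
  | var x => rfl
  | func f ts ih => simp [ih]

theorem subst_eq_self {t : L.Term V} {σ : V → L.Term V} (h : ∀ x ∈ vars t, σ x = .var x) :
    t.subst σ = t :=
  (subst_congr h).trans (subst_termVar t)

theorem mem_vars_subst {t : L.Term V} {σ : V → L.Term W} {y : W} :
    y ∈ vars (t.subst σ) ↔ ∃ x ∈ vars t, y ∈ vars (σ x) := by
  induction t with
  | var x => simp
  | func f ts ih =>
    simp only [subst_func, mem_vars_func, ih]
    exact ⟨fun ⟨i, x, hx, hy⟩ => ⟨x, ⟨i, hx⟩, hy⟩, fun ⟨x, ⟨i, hx⟩, hy⟩ => ⟨i, x, hx, hy⟩⟩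

theorem isTermOver_var (x : V) : IsTermOver F (.var x : L.Term V) := trivial

theorem isTermOver_func {n : ℕ} {f : L.Functions n} {ts : Fin n → L.Term V} :
    IsTermOver F (.func f ts) ↔ (⟨_, f⟩ : Sym L) ∈ F ∧ ∀ i, IsTermOver F (ts i) := Iff.rfl

theorem isTermOver_subst {t : L.Term V} {σ : V → L.Term W} (ht : IsTermOver F t) :
    IsTermOver F (t.subst σ) ↔ ∀ x ∈ vars t, IsTermOver F (σ x) := by
  induction t with
  | var x => simp
  | func f ts ih =>
    simp only [subst_func, isTermOver_func, ht.1, true_and, mem_vars_func, forall_exists_index]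
    exact ⟨fun h x i hx => (ih i (ht.2 i)).1 (h i) x hx,
      fun h i => (ih i (ht.2 i)).2 fun x hx => h x i hx⟩

end Terms

namespace TRS

section Reduction

variable {L : FirstOrder.Language.{u, v}} {V W X : Type*} {R : TRS L V} {s t : L.Term W}

/-- The rewrite relation of a TRS on the terms with variables in an arbitrary type `W`. Layers of
terms are terms whose variables are terms, so `V` does not suffice. -/
inductive RewriteStep (R : TRS L V) : L.Term W → L.Term W → Prop
  | root {l r : L.Term V} (h : (l, r) ∈ R.rules) (σ : V → L.Term W) :
      RewriteStep R (l.subst σ) (r.subst σ)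
  | arg {n : ℕ} (f : L.Functions n) (ts : Fin n → L.Term W) (i : Fin n) {t : L.Term W}
      (h : RewriteStep R (ts i) t) : RewriteStep R (.func f ts) (.func f (update ts i t))

/-- The reflexive transitive closure of the rewrite relation. -/
abbrev Reduces (R : TRS L V) : L.Term W → L.Term W → Prop := ReflTransGen R.RewriteStep

/-- Two terms are joinable if they have a common reduct. -/
abbrev Joinable (R : TRS L V) : L.Term W → L.Term W → Prop := Join R.Reduces

/-- Confluence of a TRS on the terms over its signature with variables in `W`. -/
def ConfluentOn (R : TRS L V) (W : Type*) : Prop :=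
  ∀ a b c : L.Term W, IsTermOver R.sig a → R.Reduces a b → R.Reduces a c → R.Joinable b c

theorem rewriteStep_eq_step : R.RewriteStep = Step R.rules := by
  ext s t
  constructor <;> intro h
  · induction h with
    | root h σ => exact .root h σ
    | arg f ts i _ ih => exact .arg f ts i ih
  · induction h with
    | root h σ => exact .root h σ
    | arg f ts i _ ih => exact .arg f ts i ih

theorem RewriteStep.mono {R' : TRS L V} (hR : R.rules ⊆ R'.rules) (h : R.RewriteStep s t) :
    R'.RewriteStep s t := by
  induction h with
  | root h σ => exact .root (hR h) σ
  | arg f ts i _ ih => exact .arg f ts i ih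

theorem RewriteStep.subst (h : R.RewriteStep s t) (τ : W → L.Term X) :
    R.RewriteStep (s.subst τ) (t.subst τ) := by
  induction h with
  | root h σ => simpa only [subst_subst] using RewriteStep.root h _
  | @arg n f ts i t _ ih =>
    have subst_update (j) : (update ts i t j).subst τ
        = update (fun j => (ts j).subst τ) i (t.subst τ) j :=
      apply_update (fun _ u => u.subst τ) ts i t j
    simpa only [subst_func, subst_update] using RewriteStep.arg f (fun j => (ts j).subst τ) i ih

theorem RewriteStep.vars_subset (h : R.RewriteStep s t) : vars t ⊆ vars s := by
  induction h with
  | root h σ =>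
    intro y hy
    obtain ⟨x, hx, hy⟩ := mem_vars_subst.1 hy
    exact mem_vars_subst.2 ⟨x, R.vars_subset _ h hx, hy⟩
  | arg f ts i _ ih =>
    intro y hy
    obtain ⟨j, hj⟩ := mem_vars_func.1 hy
    obtain rfl | hji := eq_or_ne j i
    · exact mem_vars_func.2 ⟨j, ih (by simpa using hj)⟩
    · exact mem_vars_func.2 ⟨j, by simpa [hji] using hj⟩

theorem RewriteStep.isTermOver (h : R.RewriteStep s t) (hs : IsTermOver R.sig s) :
    IsTermOver R.sig t := by
  induction h with
  | root h σ =>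
    rw [isTermOver_subst (R.lhs_over _ h)] at hs
    exact (isTermOver_subst (R.rhs_over _ h)).2 fun x hx => hs x (R.vars_subset _ h hx)
  | arg f ts i _ ih =>
    refine ⟨hs.1, (forall_update_iff ts fun _ u => IsTermOver R.sig u).2 ⟨ih (hs.2 i), ?_⟩⟩
    exact fun j _ => hs.2 j

theorem not_rewriteStep_var {x : W} : ¬ R.RewriteStep (.var x) t := by
  generalize hs : (.var x : L.Term W) = s
  rintro (⟨h, σ⟩ | _)
  · rename_i l r
    cases l with
    | var y => exact R.lhs_not_var _ h y rfl
    | func f ts => cases hs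
  · cases hs

theorem Reduces.mono {R' : TRS L V} (hR : R.rules ⊆ R'.rules) (h : R.Reduces s t) :
    R'.Reduces s t :=
  h.lift id fun _ _ h => h.mono hR

theorem Reduces.subst (h : R.Reduces s t) (τ : W → L.Term X) :
    R.Reduces (s.subst τ) (t.subst τ) :=
  h.lift (·.subst τ) fun _ _ h => h.subst τ

theorem Reduces.vars_subset (h : R.Reduces s t) : vars t ⊆ vars s := by
  induction h with
  | refl => rfl
  | tail _ h ih => exact h.vars_subset.trans ih

theorem Reduces.isTermOver (h : R.Reduces s t) (hs : IsTermOver R.sig s) :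
    IsTermOver R.sig t := by
  induction h with
  | refl => exact hs
  | tail _ h ih => exact h.isTermOver ih

theorem Reduces.eq_var {x : W} (h : R.Reduces (.var x) t) : t = .var x := by
  induction h with
  | refl => rfl
  | tail _ h ih => exact (not_rewriteStep_var (ih ▸ h)).elim

theorem Reduces.func_update {n : ℕ} (f : L.Functions n) (ts : Fin n → L.Term W) (i : Fin n)
    (h : R.Reduces (ts i) t) : R.Reduces (.func f ts) (.func f (update ts i t)) := by
  induction h with
  | refl => rw [update_eq_self]
  | @tail b c _ hbc ih =>
    refine ih.tail ?_
    simpa using RewriteStep.arg f (update ts i b) i (t := c) (by simpa using hbc)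

theorem Reduces.func {n : ℕ} (f : L.Functions n) {ts us : Fin n → L.Term W}
    (h : ∀ i, R.Reduces (ts i) (us i)) : R.Reduces (.func f ts) (.func f us) := by
  have reduces_piecewise (A : Finset (Fin n)) :
      R.Reduces (.func f ts) (.func f (A.piecewise us ts)) := by
    induction A using Finset.induction_on with
    | empty => rw [Finset.piecewise_empty]
    | insert j A hj ih =>
      rw [Finset.piecewise_insert]
      exact ih.trans (Reduces.func_update f _ j (by simpa [hj] using h j))
  simpa using reduces_piecewise Finset.univ

theorem Reduces.subst_congr {t : L.Term W} {σ τ : W → L.Term X}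
    (h : ∀ x ∈ vars t, R.Reduces (σ x) (τ x)) : R.Reduces (t.subst σ) (t.subst τ) := by
  induction t with
  | var x => exact h x (mem_vars_var.2 rfl)
  | func f ts ih => exact .func f fun i => ih i fun x hx => h x (mem_vars_func.2 ⟨i, hx⟩)

theorem Joinable.symm (h : R.Joinable s t) : R.Joinable t s :=
  let ⟨d, hs, ht⟩ := h
  ⟨d, ht, hs⟩

theorem Reduces.joinable (h : R.Reduces s t) : R.Joinable s t := ⟨t, h, .refl⟩

theorem Joinable.func {n : ℕ} (f : L.Functions n) {ts us : Fin n → L.Term W}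
    (h : ∀ i, R.Joinable (ts i) (us i)) : R.Joinable (.func f ts) (.func f us) := by
  choose ds hts hus using h
  exact ⟨.func f ds, .func f hts, .func f hus⟩

theorem Joinable.reduces_var {x : W} (h : R.Joinable t (.var x)) : R.Reduces t (.var x) := by
  obtain ⟨d, ht, hx⟩ := h
  rwa [Reduces.eq_var hx] at ht

theorem ConfluentOn.joinable_trans (hR : R.ConfluentOn W) {a b c : L.Term W}
    (hb : IsTermOver R.sig b) (hab : R.Joinable a b) (hbc : R.Joinable b c) : R.Joinable a c := by
  obtain ⟨d, had, hbd⟩ := hab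
  obtain ⟨e, hbe, hce⟩ := hbc
  obtain ⟨k, hdk, hek⟩ := hR _ _ _ hb hbd hbe
  exact ⟨k, had.trans hdk, hce.trans hek⟩

theorem isConfluent_iff_confluentOn : R.IsConfluent ↔ R.ConfluentOn V := by
  have reduces_val {s t : R.Terms} (h : ReflTransGen R.Rewrites s t) : R.Reduces s.1 t.1 :=
    h.lift Subtype.val fun _ _ h => rewriteStep_eq_step ▸ h
  have reduces_mk {s t : L.Term V} (h : R.Reduces s t) (hs : IsTermOver R.sig s) :
      ReflTransGen R.Rewrites ⟨s, hs⟩ ⟨t, h.isTermOver hs⟩ := by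
    induction h with
    | refl => exact .refl
    | tail _ h ih => exact ih.tail (show Step _ _ _ from rewriteStep_eq_step ▸ h)
  constructor
  · intro hR a b c ha hab hac
    obtain ⟨d, hbd, hcd⟩ := hR _ _ _ (reduces_mk hab ha) (reduces_mk hac ha)
    exact ⟨d.1, reduces_val hbd, reduces_val hcd⟩
  · intro hR a b c hab hac
    obtain ⟨d, hbd, hcd⟩ := hR _ _ _ a.2 (reduces_val hab) (reduces_val hac)
    exact ⟨⟨d, hbd.isTermOver b.2⟩, reduces_mk hbd b.2, reduces_mk hcd c.2⟩

theorem ConfluentOn.of_infinite [Infinite X] (hR : R.ConfluentOn X) : R.ConfluentOn W := by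
  intro a b c ha hab hac
  obtain ⟨ρ, -, hρ⟩ := (finite_vars a).exists_injOn_of_encard_le (t := (Set.univ : Set X))
    (by simp)
  let rename : W → L.Term X := fun x => .var (ρ x)
  -- Off the image of `ρ` any term does; `W` may be empty, so there need not be a variable.
  let restore : X → L.Term W := extend ((vars a).domRestrict ρ) (fun x => .var x.1) fun _ => a
  have restore_apply (x : vars a) : restore (ρ x) = .var x.1 :=
    hρ.injective.extend_apply (fun x => Term.var x.1) _ x
  have restore_rename {t : L.Term W} (ht : vars t ⊆ vars a) :
      (t.subst rename).subst restore = t := by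
    rw [subst_subst]
    exact subst_eq_self fun x hx => restore_apply ⟨x, ht hx⟩
  have restore_reduces {t : L.Term W} {d : L.Term X} (hat : R.Reduces a t)
      (htd : R.Reduces (t.subst rename) d) : R.Reduces t (d.subst restore) := by
    simpa only [restore_rename hat.vars_subset] using htd.subst restore
  obtain ⟨d, hbd, hcd⟩ := hR _ _ _ ((isTermOver_subst ha).2 fun x _ => isTermOver_var (ρ x))
    (hab.subst rename) (hac.subst rename)
  exact ⟨d.subst restore, restore_reduces hab hbd, restore_reduces hac hcd⟩

end Reduction

section Representatives

variable {L : FirstOrder.Language.{u, v}} {V W : Type*} {R : TRS L V} {p q : L.Term W}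

/-- The terms over the signature of a TRS that are joinable with `p`. -/
def joinClass (R : TRS L V) (p : L.Term W) : Set (L.Term W) :=
  {q | IsTermOver R.sig q ∧ R.Joinable p q}

/-- The quantity minimized by representatives of joinability classes: variables come first, other
terms are compared by the number of their variables. -/
noncomputable def varCost : L.Term W → ℕ
  | .var _ => 0
  | .func f ts => (vars (.func f ts : L.Term W)).ncard + 1

/-- A representative of the terms over the signature of a TRS that are joinable with `p`. It has
minimal cost, so that it is a variable if possible and contains no variables that some joinable
term avoids. It is meaningful only if `p` is a term over the signature. -/
noncomputable def rep (R : TRS L V) (p : L.Term W) : L.Term W :=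
  @Classical.epsilon _ ⟨p⟩ (MinimalFor (· ∈ R.joinClass p) varCost)

theorem self_mem_joinClass (hp : IsTermOver R.sig p) : p ∈ R.joinClass p := ⟨hp, p, .refl, .refl⟩

theorem minimalFor_rep (hp : IsTermOver R.sig p) :
    MinimalFor (· ∈ R.joinClass p) varCost (R.rep p) :=
  Classical.epsilon_spec (p := MinimalFor (· ∈ R.joinClass p) varCost)
    ⟨_, isMinimalFor_argminOn varCost _ ⟨p, self_mem_joinClass hp⟩⟩

theorem isTermOver_rep (hp : IsTermOver R.sig p) : IsTermOver R.sig (R.rep p) :=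
  (minimalFor_rep hp).1.1

theorem joinable_rep (hp : IsTermOver R.sig p) : R.Joinable p (R.rep p) :=
  (minimalFor_rep hp).1.2

theorem rep_var (x : W) : R.rep (.var x) = .var x := by
  have hx := isTermOver_var (F := R.sig) x
  have hcost := (minimalFor_rep hx).2 (self_mem_joinClass hx) (by simp [varCost])
  have hred := (joinable_rep hx).symm.reduces_var
  cases h : R.rep (.var x) with
  | var y => exact (Reduces.eq_var (h ▸ hred)).symm
  | func f ts => simp [h, varCost] at hcost

theorem vars_rep_subset (hp : IsTermOver R.sig p) : vars (R.rep p) ⊆ vars p := by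
  obtain ⟨k, hpk, hrk⟩ := joinable_rep hp
  refine subset_trans ?_ hpk.vars_subset
  have hk : k ∈ R.joinClass p := ⟨hpk.isTermOver hp, hpk.joinable⟩
  have hmin : varCost k ≤ varCost (R.rep p) → varCost (R.rep p) ≤ varCost k :=
    (minimalFor_rep hp).2 hk
  cases hr : R.rep p with
  | var x =>
    rw [hr] at hrk
    rw [Reduces.eq_var hrk]
  | func f ts =>
    rw [hr] at hrk hmin
    have hcard := Set.ncard_le_ncard hrk.vars_subset (finite_vars _)
    cases k with
    | var x => simp [varCost] at hmin
    | func g us =>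
      simp only [varCost] at hmin
      exact (Set.eq_of_subset_of_ncard_le hrk.vars_subset (by omega) (finite_vars _)).ge

theorem ConfluentOn.rep_eq_rep_iff (hR : R.ConfluentOn W) (hp : IsTermOver R.sig p)
    (hq : IsTermOver R.sig q) : R.rep p = R.rep q ↔ R.Joinable p q := by
  constructor
  · intro h
    exact hR.joinable_trans (isTermOver_rep hp) (joinable_rep hp) (h ▸ (joinable_rep hq).symm)
  · intro h
    have hclass : R.joinClass p = R.joinClass q := by
      ext k
      exact and_congr_right fun _ => ⟨hR.joinable_trans hp h.symm, hR.joinable_trans hq h⟩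
    simp only [rep, hclass]

theorem ConfluentOn.rep_rep (hR : R.ConfluentOn W) (hp : IsTermOver R.sig p) :
    R.rep (R.rep p) = R.rep p :=
  ((hR.rep_eq_rep_iff hp (isTermOver_rep hp)).2 (joinable_rep hp)).symm

end Representatives

section Union

variable {L : FirstOrder.Language.{u, v}} {V : Type*} {ι : Type*}

/-- The union of a family of TRSs: unite the signatures and the sets of rules. -/
def iUnion (R : ι → TRS L V) : TRS L V where
  sig := ⋃ c, (R c).sig
  rules := ⋃ c, (R c).rules
  lhs_over ρ h := by
    obtain ⟨c, hc⟩ := Set.mem_iUnion.1 h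
    exact ((R c).lhs_over ρ hc).mono (Set.subset_iUnion _ c)
  rhs_over ρ h := by
    obtain ⟨c, hc⟩ := Set.mem_iUnion.1 h
    exact ((R c).rhs_over ρ hc).mono (Set.subset_iUnion _ c)
  lhs_not_var ρ h := by
    obtain ⟨c, hc⟩ := Set.mem_iUnion.1 h
    exact (R c).lhs_not_var ρ hc
  vars_subset ρ h := by
    obtain ⟨c, hc⟩ := Set.mem_iUnion.1 h
    exact (R c).vars_subset ρ hc

theorem union_eq_iUnion (R₁ R₂ : TRS L V) : R₁.union R₂ = iUnion fun b => cond b R₁ R₂ := by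
  simp only [union, iUnion, mk.injEq, Set.union_eq_iUnion]
  constructor <;> exact Set.iUnion_congr (Bool.rec rfl rfl)

end Union

end TRS

section Layers

variable {L : FirstOrder.Language.{u, v}} {V X : Type*} {F : Set (Sym L)}

/-- The root of the term is a function symbol in `F`. -/
def IsRootedIn (F : Set (Sym L)) : L.Term V → Prop
  | .var _ => False
  | .func f _ => (⟨_, f⟩ : Sym L) ∈ F

open Classical in
/-- The top layer of a term with respect to the signature `F`: its variables are the maximal
subterms whose root is not in `F`. -/
noncomputable def cap (F : Set (Sym L)) : L.Term V → L.Term (L.Term V)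
  | .var x => .var (.var x)
  | .func f ts =>
    if (⟨_, f⟩ : Sym L) ∈ F then .func f fun i => cap F (ts i) else .var (.func f ts)

/-- The aliens of a term: its maximal subterms whose root is not in `F`. -/
def aliens (F : Set (Sym L)) (t : L.Term V) : Set (L.Term V) := vars (cap F t)

theorem cap_of_not_isRootedIn {t : L.Term V} (h : ¬ IsRootedIn F t) : cap F t = .var t := by
  cases t with
  | var x => rfl
  | func f ts => exact if_neg h

theorem cap_func {n : ℕ} {f : L.Functions n} (hf : (⟨_, f⟩ : Sym L) ∈ F)
    (ts : Fin n → L.Term V) : cap F (.func f ts) = .func f fun i => cap F (ts i) :=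
  if_pos hf

theorem mem_aliens_of_not_isRootedIn {t a : L.Term V} (h : ¬ IsRootedIn F t) :
    a ∈ aliens F t ↔ a = t := by
  rw [aliens, cap_of_not_isRootedIn h, mem_vars_var]

theorem mem_aliens_func {n : ℕ} {f : L.Functions n} (hf : (⟨_, f⟩ : Sym L) ∈ F)
    {ts : Fin n → L.Term V} {a : L.Term V} :
    a ∈ aliens F (.func f ts) ↔ ∃ i, a ∈ aliens F (ts i) := by
  rw [aliens, cap_func hf, mem_vars_func]
  rfl

theorem finite_aliens (t : L.Term V) : (aliens F t).Finite := finite_vars _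

theorem isTermOver_cap (t : L.Term V) : IsTermOver F (cap F t) := by
  induction t with
  | var => trivial
  | func f ts ih =>
    by_cases hf : IsRootedIn F (.func f ts)
    · rw [cap_func hf]
      exact ⟨hf, ih⟩
    · rw [cap_of_not_isRootedIn hf]
      trivial

theorem not_isRootedIn_of_mem_aliens {t a : L.Term V} (ha : a ∈ aliens F t) :
    ¬ IsRootedIn F a := by
  induction t with
  | var x =>
    rw [(mem_aliens_of_not_isRootedIn (t := .var x) id).1 ha]
    exact id
  | func f ts ih =>
    by_cases hf : IsRootedIn F (.func f ts)
    · obtain ⟨i, hi⟩ := (mem_aliens_func hf).1 ha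
      exact ih i hi
    · rwa [(mem_aliens_of_not_isRootedIn hf).1 ha]

theorem subst_id_cap (t : L.Term V) : (cap F t).subst id = t := by
  induction t with
  | var x => rfl
  | func f ts ih =>
    by_cases hf : IsRootedIn F (.func f ts)
    · simp [cap_func hf, ih]
    · rw [cap_of_not_isRootedIn hf, subst_var, id]

theorem cap_subst {p : L.Term X} (hp : IsTermOver F p) (σ : X → L.Term V) :
    cap F (p.subst σ) = p.subst fun x => cap F (σ x) := by
  induction p with
  | var x => rfl
  | func f ts ih =>
    rw [subst_func, cap_func hp.1, subst_func]
    exact congrArg (Term.func f) (funext fun i => ih i (hp.2 i))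

theorem mem_aliens_subst {p : L.Term X} (hp : IsTermOver F p) {σ : X → L.Term V}
    {a : L.Term V} : a ∈ aliens F (p.subst σ) ↔ ∃ x ∈ vars p, a ∈ aliens F (σ x) := by
  rw [aliens, cap_subst hp, mem_vars_subst]
  rfl

theorem cap_subst_id {p : L.Term (L.Term V)} (hp : IsTermOver F p)
    (h : ∀ a ∈ vars p, ¬ IsRootedIn F a) : cap F (p.subst id) = p := by
  rw [cap_subst hp]
  exact subst_eq_self fun a ha => cap_of_not_isRootedIn (h a ha)

theorem TRS.cap_subst_id_rep {R : TRS L V} {p : L.Term (L.Term V)} (hp : IsTermOver R.sig p)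
    (h : ∀ a ∈ vars p, ¬ IsRootedIn R.sig a) : cap R.sig ((R.rep p).subst id) = R.rep p :=
  cap_subst_id (isTermOver_rep hp) fun a ha => h a (vars_rep_subset hp ha)

end Layers

section Family

variable {L : FirstOrder.Language.{u, v}} {V : Type w} {ι : Type*} {R : ι → TRS L V} {c d : ι}
  {s t : L.Term V}

section Disjoint

variable (hdisj : Pairwise (Disjoint on fun c => (R c).sig))
include hdisj

theorem eq_of_mem_sig {f : Sym L} (hc : f ∈ (R c).sig) (hd : f ∈ (R d).sig) : c = d :=
  hdisj.eq (Set.not_disjoint_iff.2 ⟨f, hc, hd⟩)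

theorem IsRootedIn.unique (hc : IsRootedIn (R c).sig t) (hd : IsRootedIn (R d).sig t) :
    c = d := by
  cases t with
  | var x => exact hc.elim
  | func f ts => exact eq_of_mem_sig hdisj hc hd

theorem exists_mem_aliens_of_rewriteStep (h : (TRS.iUnion R).RewriteStep s t) {b : L.Term V}
    (hb : b ∈ aliens (R c).sig t) :
    ∃ a ∈ aliens (R c).sig s, a = b ∨
      ∃ a', (TRS.iUnion R).RewriteStep a a' ∧ b ∈ aliens (R c).sig a' := by
  by_cases hs : IsRootedIn (R c).sig s
  swap
  · exact ⟨s, (mem_aliens_of_not_isRootedIn hs).2 rfl, .inr ⟨t, h, hb⟩⟩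
  induction h with
  | @root l r hlr σ =>
    obtain ⟨d, hd⟩ := Set.mem_iUnion.1 hlr
    have hl := (R d).lhs_over _ hd
    obtain rfl : d = c := by
      cases l with
      | var x => exact ((R d).lhs_not_var _ hd x rfl).elim
      | func f ts => exact eq_of_mem_sig hdisj hl.1 hs
    obtain ⟨x, hx, hb⟩ := (mem_aliens_subst ((R d).rhs_over _ hd)).1 hb
    exact ⟨b, (mem_aliens_subst hl).2 ⟨x, (R d).vars_subset _ hd hx, hb⟩, .inl rfl⟩
  | @arg n f ts i t h ih =>
    simp only [mem_aliens_func hs] at hb ⊢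
    obtain ⟨j, hj⟩ := hb
    obtain rfl | hji := eq_or_ne j i
    · rw [update_self] at hj
      by_cases hr : IsRootedIn (R c).sig (ts j)
      · obtain ⟨a, ha, hab⟩ := ih hj hr
        exact ⟨a, ⟨j, ha⟩, hab⟩
      · exact ⟨ts j, ⟨j, (mem_aliens_of_not_isRootedIn hr).2 rfl⟩, .inr ⟨t, h, hj⟩⟩
    · rw [update_of_ne hji] at hj
      exact ⟨b, ⟨j, hj⟩, .inl rfl⟩

end Disjoint

open Classical in
/-- The normal form of a term with respect to joinability in a disjoint union: bottom up, every
layer is replaced by the representative of its joinability class. Symbols outside of all the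
signatures are left alone. -/
noncomputable def nf (R : ι → TRS L V) : L.Term V → L.Term V
  | .var x => .var x
  | .func f ts =>
    if h : ∃ c, (⟨_, f⟩ : Sym L) ∈ (R c).sig then
      ((R h.choose).rep (.func f fun i => cap (R h.choose).sig (nf R (ts i)))).subst id
    else .func f fun i => nf R (ts i)

/-- All layers of the term are representatives of their joinability classes. -/
inductive Canonical (R : ι → TRS L V) : L.Term V → Prop
  | of_not_isRootedIn {t : L.Term V} (h : ∀ c, ¬ IsRootedIn (R c).sig t) : Canonical R t
  | layer {c : ι} {t : L.Term V} (hc : IsRootedIn (R c).sig t)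
      (hrep : (R c).rep (cap (R c).sig t) = cap (R c).sig t)
      (h : ∀ a ∈ aliens (R c).sig t, Canonical R a) : Canonical R t

theorem nf_func (hdisj : Pairwise (Disjoint on fun c => (R c).sig)) {n : ℕ} {f : L.Functions n}
    (hf : (⟨_, f⟩ : Sym L) ∈ (R c).sig) (ts : Fin n → L.Term V) :
    nf R (.func f ts) = ((R c).rep (.func f fun i => cap (R c).sig (nf R (ts i)))).subst id := by
  have h : ∃ c, (⟨_, f⟩ : Sym L) ∈ (R c).sig := ⟨c, hf⟩
  rw [nf, dif_pos h, eq_of_mem_sig hdisj h.choose_spec hf]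

theorem Canonical.rep_cap (hdisj : Pairwise (Disjoint on fun c => (R c).sig))
    (h : Canonical R t) : (R c).rep (cap (R c).sig t) = cap (R c).sig t := by
  by_cases hc : IsRootedIn (R c).sig t
  · cases h with
    | of_not_isRootedIn h => exact (h c hc).elim
    | layer hd hrep _ => exact hc.unique hdisj hd ▸ hrep
  · rw [cap_of_not_isRootedIn hc, TRS.rep_var]

theorem Canonical.of_mem_aliens (hdisj : Pairwise (Disjoint on fun c => (R c).sig))
    (h : Canonical R t) {a : L.Term V} (ha : a ∈ aliens (R c).sig t) : Canonical R a := by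
  by_cases hc : IsRootedIn (R c).sig t
  · cases h with
    | of_not_isRootedIn h => exact (h c hc).elim
    | layer hd _ h => exact h a (hc.unique hdisj hd ▸ ha)
  · rwa [(mem_aliens_of_not_isRootedIn hc).1 ha]

theorem canonical_subst_id_rep (hR : (R c).ConfluentOn (L.Term V)) {p : L.Term (L.Term V)}
    (hp : IsTermOver (R c).sig p) (h : ∀ a ∈ vars p, ¬ IsRootedIn (R c).sig a)
    (hcan : ∀ a ∈ vars p, Canonical R a) : Canonical R (((R c).rep p).subst id) := by
  have hover := TRS.isTermOver_rep hp
  have hvars := TRS.vars_rep_subset hp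
  have hcap := TRS.cap_subst_id_rep hp h
  have hrep := hR.rep_rep hp
  generalize (R c).rep p = r at hover hvars hcap hrep ⊢
  cases r with
  | var a => exact hcan a (hvars (mem_vars_var.2 rfl))
  | func f ts =>
    refine .layer (c := c) hover.1 (by rw [hcap, hrep]) fun a ha => hcan a (hvars ?_)
    rwa [aliens, hcap] at ha

section Confluent

variable (hdisj : Pairwise (Disjoint on fun c => (R c).sig))
  (hconf : ∀ c, (R c).ConfluentOn (L.Term V))
include hdisj hconf

theorem canonical_nf (t : L.Term V) : Canonical R (nf R t) := by
  induction t with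
  | var x => exact .of_not_isRootedIn fun _ => id
  | func f ts ih =>
    by_cases h : ∃ c, (⟨_, f⟩ : Sym L) ∈ (R c).sig
    · obtain ⟨c, hf⟩ := h
      rw [nf_func hdisj hf]
      refine canonical_subst_id_rep (hconf c) ⟨hf, fun i => isTermOver_cap _⟩
        (fun a ha => ?_) fun a ha => ?_
      all_goals obtain ⟨i, hi⟩ := mem_vars_func.1 ha
      · exact not_isRootedIn_of_mem_aliens hi
      · exact (ih i).of_mem_aliens hdisj hi
    · rw [nf, dif_neg h]
      exact .of_not_isRootedIn fun c hc => h ⟨c, hc⟩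

theorem nf_subst {X : Type*} {p : L.Term X} (hp : IsTermOver (R c).sig p) (σ : X → L.Term V) :
    nf R (p.subst σ)
      = ((R c).rep (p.subst fun x => cap (R c).sig (nf R (σ x)))).subst id := by
  induction p with
  | var x =>
    rw [subst_var, subst_var, (canonical_nf hdisj hconf _).rep_cap hdisj, subst_id_cap]
  | func f ts ih =>
    have hover (i) : IsTermOver (R c).sig ((ts i).subst fun x => cap (R c).sig (nf R (σ x))) :=
      (isTermOver_subst (hp.2 i)).2 fun x _ => isTermOver_cap _
    have hcap (i) : cap (R c).sig (nf R ((ts i).subst σ))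
        = (R c).rep ((ts i).subst fun x => cap (R c).sig (nf R (σ x))) := by
      rw [ih i (hp.2 i)]
      refine TRS.cap_subst_id_rep (hover i) fun a ha => ?_
      obtain ⟨x, -, ha⟩ := mem_vars_subst.1 ha
      exact not_isRootedIn_of_mem_aliens ha
    rw [subst_func, nf_func hdisj hp.1, subst_func]
    simp only [hcap]
    congr 1
    exact ((hconf c).rep_eq_rep_iff
      (isTermOver_func.2 ⟨hp.1, fun i => TRS.isTermOver_rep (hover i)⟩)
      (isTermOver_func.2 ⟨hp.1, hover⟩)).2 (.func f fun i => (TRS.joinable_rep (hover i)).symm)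

theorem nf_eq_of_rewriteStep (h : (TRS.iUnion R).RewriteStep s t) : nf R s = nf R t := by
  induction h with
  | @root l r hlr σ =>
    obtain ⟨c, hc⟩ := Set.mem_iUnion.1 hlr
    have hl := (R c).lhs_over _ hc
    have hr := (R c).rhs_over _ hc
    rw [nf_subst hdisj hconf hl, nf_subst hdisj hconf hr]
    congr 1
    exact ((hconf c).rep_eq_rep_iff ((isTermOver_subst hl).2 fun x _ => isTermOver_cap _)
      ((isTermOver_subst hr).2 fun x _ => isTermOver_cap _)).2
      (TRS.Reduces.joinable (.single (.root hc _)))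
  | @arg n f ts i t h ih =>
    have nf_update (j) : nf R (update ts i t j) = nf R (ts j) := by
      obtain rfl | hj := eq_or_ne j i
      · rw [update_self, ih]
      · rw [update_of_ne hj]
    simp only [nf, nf_update]

theorem nf_eq_of_reduces (h : (TRS.iUnion R).Reduces s t) : nf R s = nf R t := by
  induction h with
  | refl => rfl
  | tail _ h ih => exact ih.trans (nf_eq_of_rewriteStep hdisj hconf h)

end Confluent

/-- The top layer of a term over the signature of `R c`, with the aliens replaced by their normal
forms. Aliens that will be joined thereby become equal variables. -/
noncomputable def nfLayer (R : ι → TRS L V) (c : ι) (t : L.Term V) : L.Term (L.Term V) :=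
  (cap (R c).sig t).subst fun a => .var (nf R a)

theorem isTermOver_nfLayer (t : L.Term V) : IsTermOver (R c).sig (nfLayer R c t) :=
  (isTermOver_subst (isTermOver_cap t)).2 fun _ _ => trivial

theorem mem_vars_nfLayer {b : L.Term V} :
    b ∈ vars (nfLayer R c t) ↔ ∃ a ∈ aliens (R c).sig t, b = nf R a := by
  simp only [nfLayer, mem_vars_subst, mem_vars_var, aliens]

theorem reduces_subst_of_nfLayer_reduces {φ : L.Term V → L.Term V} {p : L.Term (L.Term V)}
    (hφ : ∀ a ∈ aliens (R c).sig t, (TRS.iUnion R).Reduces a (φ (nf R a)))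
    (hp : (R c).Reduces (nfLayer R c t) p) : (TRS.iUnion R).Reduces t (p.subst φ) := by
  have haliens : (TRS.iUnion R).Reduces t ((nfLayer R c t).subst φ) := by
    simpa only [nfLayer, subst_subst, subst_var, subst_id_cap] using
      TRS.Reduces.subst_congr (t := cap (R c).sig t) (σ := id) (τ := fun a => φ (nf R a)) hφ
  exact haliens.trans ((hp.mono (Set.subset_iUnion (fun c => (R c).rules) c)).subst φ)

theorem cap_nf (hdisj : Pairwise (Disjoint on fun c => (R c).sig))
    (hconf : ∀ c, (R c).ConfluentOn (L.Term V))
    (h : ∀ a ∈ aliens (R c).sig t, ¬ IsRootedIn (R c).sig (nf R a)) :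
    cap (R c).sig (nf R t) = (R c).rep (nfLayer R c t) := by
  have hnf : nf R t = ((R c).rep (nfLayer R c t)).subst id := by
    conv_lhs => rw [← subst_id_cap (F := (R c).sig) t, nf_subst hdisj hconf (isTermOver_cap t)]
    exact congrArg (fun p => ((R c).rep p).subst id)
      (subst_congr fun a ha => cap_of_not_isRootedIn (h a ha))
  rw [hnf]
  refine TRS.cap_subst_id_rep (isTermOver_nfLayer t) fun b hb => ?_
  obtain ⟨a, ha, rfl⟩ := mem_vars_nfLayer.1 hb
  exact h a ha

/-- The term has at most `n` nested layers, and taking normal forms keeps them apart: the roots of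
the term and, hereditarily, of its aliens belong to the same signatures as the roots of their
normal forms. -/
inductive Stable (R : ι → TRS L V) : ℕ → L.Term V → Prop
  | var (n : ℕ) (x : V) : Stable R n (.var x)
  | layer {n : ℕ} {c : ι} {t : L.Term V} (hc : IsRootedIn (R c).sig t)
      (hnf : IsRootedIn (R c).sig (nf R t)) (h : ∀ a ∈ aliens (R c).sig t, Stable R n a) :
      Stable R (n + 1) t

namespace Stable

variable {n : ℕ}

theorem mono {m : ℕ} (h : Stable R m t) (hmn : m ≤ n) : Stable R n t := by
  induction h generalizing n with
  | var m x => exact .var n x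
  | layer hc hnf _ ih =>
    obtain ⟨k, rfl⟩ := Nat.exists_eq_add_of_lt hmn
    exact .layer hc hnf fun a ha => ih a ha (by omega)

theorem eq_var {x : V} (h : Stable R n t) (ht : nf R t = .var x) : t = .var x := by
  cases h with
  | var _ y => exact ht
  | layer _ hnf _ => exact (ht ▸ hnf : IsRootedIn _ (.var x)).elim

section Disjoint

variable (hdisj : Pairwise (Disjoint on fun c => (R c).sig))
include hdisj

theorem isRootedIn_nf_iff (h : Stable R n t) :
    IsRootedIn (R c).sig (nf R t) ↔ IsRootedIn (R c).sig t := by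
  cases h with
  | var _ x => rfl
  | layer hd hnf _ =>
    exact ⟨fun hc => hc.unique hdisj hnf ▸ hd, fun hc => hc.unique hdisj hd ▸ hnf⟩

theorem of_mem_aliens (h : Stable R n t) {a : L.Term V} (ha : a ∈ aliens (R c).sig t) :
    Stable R n a := by
  by_cases hc : IsRootedIn (R c).sig t
  · cases h with
    | var _ x => exact hc.elim
    | layer hd _ h => exact (h a (hc.unique hdisj hd ▸ ha)).mono (Nat.le_succ _)
  · rwa [(mem_aliens_of_not_isRootedIn hc).1 ha]

theorem of_isRootedIn_nf (hnf : IsRootedIn (R c).sig (nf R t))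
    (h : ∀ a ∈ aliens (R c).sig t, Stable R n a) : Stable R (n + 1) t := by
  refine .layer ?_ hnf h
  by_contra hc
  have ht : Stable R n t := h t ((mem_aliens_of_not_isRootedIn hc).2 rfl)
  exact hc ((ht.isRootedIn_nf_iff hdisj).1 hnf)

end Disjoint

section Confluent

variable (hdisj : Pairwise (Disjoint on fun c => (R c).sig))
  (hconf : ∀ c, (R c).ConfluentOn (L.Term V))
include hdisj hconf

theorem rewriteStep (hs : Stable R n s) (h : (TRS.iUnion R).RewriteStep s t) :
    Stable R n t := by
  induction hs generalizing t with
  | var _ x => exact (TRS.not_rewriteStep_var h).elim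
  | layer _ hnf haliens ih =>
    refine of_isRootedIn_nf hdisj (nf_eq_of_rewriteStep hdisj hconf h ▸ hnf) fun b hb => ?_
    obtain ⟨a, ha, rfl | ⟨a', haa', hb⟩⟩ := exists_mem_aliens_of_rewriteStep hdisj h hb
    · exact haliens a ha
    · exact (ih a ha haa').of_mem_aliens hdisj hb

theorem reduces (hs : Stable R n s) (h : (TRS.iUnion R).Reduces s t) : Stable R n t := by
  induction h with
  | refl => exact hs
  | tail _ h ih => exact ih.rewriteStep hdisj hconf h

theorem cap_nf_of_aliens (h : ∀ a ∈ aliens (R c).sig t, Stable R n a) :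
    cap (R c).sig (nf R t) = (R c).rep (nfLayer R c t) :=
  cap_nf hdisj hconf fun a ha hnf =>
    not_isRootedIn_of_mem_aliens ha (((h a ha).isRootedIn_nf_iff hdisj).1 hnf)

end Confluent

end Stable

section Modularity

variable (hdisj : Pairwise (Disjoint on fun c => (R c).sig))
  (hconf : ∀ c, (R c).ConfluentOn (L.Term V)) {n : ℕ}
include hdisj hconf

theorem exists_common_reducts
    (hjoin : ∀ ⦃s t⦄, Stable R n s → Stable R n t → nf R s = nf R t →
      (TRS.iUnion R).Joinable s t)
    {A : Set (L.Term V)} (hfin : A.Finite) (hA : ∀ a ∈ A, Stable R n a) :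
    ∃ φ : L.Term V → L.Term V, ∀ a ∈ A, (TRS.iUnion R).Reduces a (φ (nf R a)) := by
  rcases isEmpty_or_nonempty (L.Term V) with _ | _
  · exact ⟨id, fun a => isEmptyElim a⟩
  refine exists_bound_on_fibers (P := {a | Stable R n a}) (fun k => ?_) hfin hA
  rintro a ⟨ha, rfl⟩ b ⟨hb, hba⟩
  obtain ⟨e, hae, hbe⟩ := hjoin ha hb hba.symm
  exact ⟨e, ⟨ha.reduces hdisj hconf hae, (nf_eq_of_reduces hdisj hconf hae).symm⟩, hae, hbe⟩

theorem Stable.joinable (hs : Stable R n s) (ht : Stable R n t) (hst : nf R s = nf R t) :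
    (TRS.iUnion R).Joinable s t := by
  induction n generalizing s t with
  | zero =>
    cases hs with
    | var _ x => exact ht.eq_var hst.symm ▸ ⟨_, .refl, .refl⟩
  | succ n ih =>
    cases hs with
    | var _ x => exact ht.eq_var hst.symm ▸ ⟨_, .refl, .refl⟩
    | @layer _ c _ hsc hsnf hsn =>
      have htc : IsRootedIn (R c).sig t := (ht.isRootedIn_nf_iff hdisj).1 (hst ▸ hsnf)
      have htn : ∀ a ∈ aliens (R c).sig t, Stable R n a := by
        cases ht with
        | var _ x => exact htc.elim
        | layer htd _ htn => exact htc.unique hdisj htd ▸ htn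
      have hrep : (R c).rep (nfLayer R c s) = (R c).rep (nfLayer R c t) := by
        rw [← cap_nf_of_aliens hdisj hconf hsn, hst, cap_nf_of_aliens hdisj hconf htn]
      obtain ⟨p, hsp, htp⟩ := ((hconf c).rep_eq_rep_iff (isTermOver_nfLayer s)
        (isTermOver_nfLayer t)).1 hrep
      obtain ⟨φ, hφ⟩ := exists_common_reducts hdisj hconf (fun _ _ => ih)
        ((finite_aliens s).union (finite_aliens t)) fun a ha => ha.elim (hsn a) (htn a)
      exact ⟨p.subst φ, reduces_subst_of_nfLayer_reduces (fun a ha => hφ a (.inl ha)) hsp,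
        reduces_subst_of_nfLayer_reduces (fun a ha => hφ a (.inr ha)) htp⟩

theorem exists_stable_reduct_of_collapse (h : ∀ a ∈ aliens (R c).sig s, Stable R n a)
    (hnf : ¬ IsRootedIn (R c).sig (nf R s)) :
    ∃ t, (TRS.iUnion R).Reduces s t ∧ Stable R n t := by
  have hrep : (R c).rep (nfLayer R c s) = .var (nf R s) := by
    rw [← Stable.cap_nf_of_aliens hdisj hconf h, cap_of_not_isRootedIn hnf]
  have hcollapse : (R c).Reduces (nfLayer R c s) (.var (nf R s)) :=
    (hrep ▸ TRS.joinable_rep (isTermOver_nfLayer s) : (R c).Joinable _ _).reduces_var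
  obtain ⟨a, ha, hsa⟩ := mem_vars_nfLayer.1 (hcollapse.vars_subset (mem_vars_var.2 rfl))
  obtain ⟨φ, hφ⟩ := exists_common_reducts hdisj hconf
    (fun _ _ => Stable.joinable hdisj hconf) (finite_aliens s) h
  exact ⟨φ (nf R s), reduces_subst_of_nfLayer_reduces hφ hcollapse,
    (h a ha).reduces hdisj hconf (hsa ▸ hφ a ha)⟩

theorem exists_stable_reduct (ht : IsTermOver (TRS.iUnion R).sig t) :
    ∃ t' n, (TRS.iUnion R).Reduces t t' ∧ Stable R n t' := by
  induction t with
  | var x => exact ⟨_, 0, .refl, .var 0 x⟩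
  | func f ts ih =>
    obtain ⟨c, hf⟩ := Set.mem_iUnion.1 ht.1
    choose us n hus hn using fun i => ih i (ht.2 i)
    have htu : (TRS.iUnion R).Reduces (.func f ts) (.func f us) := .func f hus
    have haliens : ∀ a ∈ aliens (R c).sig (.func f us), Stable R (Finset.univ.sup n) a := by
      intro a ha
      obtain ⟨i, hi⟩ := (mem_aliens_func hf).1 ha
      exact ((hn i).mono (Finset.le_sup (Finset.mem_univ i))).of_mem_aliens hdisj hi
    by_cases hnf : IsRootedIn (R c).sig (nf R (.func f us))
    · exact ⟨_, _, htu, .of_isRootedIn_nf hdisj hnf haliens⟩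
    · obtain ⟨t', hut', ht'⟩ := exists_stable_reduct_of_collapse hdisj hconf haliens hnf
      exact ⟨t', _, htu.trans hut', ht'⟩

theorem joinable_of_nf_eq (hs : IsTermOver (TRS.iUnion R).sig s)
    (ht : IsTermOver (TRS.iUnion R).sig t) (hst : nf R s = nf R t) :
    (TRS.iUnion R).Joinable s t := by
  obtain ⟨s', m, hss', hs'⟩ := exists_stable_reduct hdisj hconf hs
  obtain ⟨t', n, htt', ht'⟩ := exists_stable_reduct hdisj hconf ht
  have hst' : nf R s' = nf R t' := by
    rw [← nf_eq_of_reduces hdisj hconf hss', hst, nf_eq_of_reduces hdisj hconf htt']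
  obtain ⟨e, hs'e, ht'e⟩ := (hs'.mono (le_max_left m n)).joinable hdisj hconf
    (ht'.mono (le_max_right m n)) hst'
  exact ⟨e, hss'.trans hs'e, htt'.trans ht'e⟩

end Modularity

end Family

end TermRewriting

open TermRewriting Function in
theorem mainTheorem6_general {L : FirstOrder.Language.{u, v}} {V : Type w} [Infinite V]
    {ι : Type*} (R : ι → TRS L V) (hdisj : Pairwise (Disjoint on fun c => (R c).sig))
    (h : ∀ c, (R c).IsConfluent) : (TRS.iUnion R).IsConfluent := by
  have hconf (c : ι) : (R c).ConfluentOn (L.Term V) :=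
    (TRS.isConfluent_iff_confluentOn.1 (h c)).of_infinite
  rw [TRS.isConfluent_iff_confluentOn]
  intro a b c ha hab hac
  have hnf : nf R b = nf R c :=
    (nf_eq_of_reduces hdisj hconf hab).symm.trans (nf_eq_of_reduces hdisj hconf hac)
  exact joinable_of_nf_eq hdisj hconf (hab.isTermOver ha) (hac.isTermOver ha) hnf

theorem mainTheorem6 {L : FirstOrder.Language.{u, v}} {V : Type w}
    [Countable V] [Infinite V] (R₁ R₂ : TermRewriting.TRS L V)
    (hdisj : R₁.sig ∩ R₂.sig = ∅) (h₁ : R₁.IsConfluent) (h₂ : R₂.IsConfluent) :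
    (R₁.union R₂).IsConfluent := by
  rw [TermRewriting.TRS.union_eq_iUnion]
  refine mainTheorem6_general _ ?_ (Bool.rec h₂ h₁)
  simpa only [Bool.apply_cond, pairwise_disjoint_on_bool, Set.disjoint_iff_inter_eq_empty]
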